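/- Let $\mathcal{A}$ be an abelian category with enough projective objects. For a complex $X_\bullet=(X_i,d_i\colon X_i\to X_{i-1})_{i\in\mathbb{Z}}$ over $\mathcal{A}$ put $\sup(X_\bullet)=\sup\{i\mid X_i\neq 0\}$ and $\mathrm{hsup}(X_\bullet)=\sup\{i\mid H_i(X_\bullet)\neq 0\}$. A quasi-projective resolution of an object $M$ is a bounded below complex $P_\bullet$ of projective objects such that $H_j(P_\bullet)\cong M^{n_j}$ for all $j$, with integers $n_j\ge 0$ that are not all zero; it is finite if $P_\bullet$ is also bounded above. For $M\ne 0$, the quasi-projective dimension $\mathrm{qpd}_{\mathcal{A}}M$ is the infimum of $\sup(P_\bullet)-\mathrm{hsup}(P_\bullet)$ over all finite quasi-projective resolutions $P_\bullet$ of $M$ (it is $\infty$ if there are none). Let $\mathcal{P}$ be a full subcategory of $\mathcal{A}$ that consists of (not necessarily all) projective objects and is closed under direct summands and finite direct sums. Let $M$ be a nonzero object of $\mathcal{A}$ with $\mathrm{qpd}_{\mathcal{A}}M<\infty$, and suppose that $M$ has a projective resolution $\cdots\to Q_1\to Q_0\to M\to 0$ with all $Q_i\in\mathcal{P}$. Put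 $r=\mathrm{qpd}_{\mathcal{A}}M$. Then there exist an integer $s\ge 0$ and a bounded complex $$P_\bullet:\quad 0\to P_r\xrightarrow{d_r}\cdots\xrightarrow{d_2} P_1\xrightarrow{d_1}P_0\xrightarrow{d_0}P_{-1}\to\cdots\to P_{-s}\to 0$$ with all terms in $\mathcal{P}$ and $\mathrm{hsup}(P_\bullet)=0$ such that the following hold. (a) $P_\bullet$ is a quasi-projective resolution of $M$, and $\mathrm{qpd}_{\mathcal{A}}M=\mathrm{pd}_{\mathcal{A}}N$, where $N=\mathrm{Coker}(d_1)$. (b) Let $F\colon\mathcal{A}\to\mathcal{B}$ be a right exact (additive, covariant) functor to an abelian category $\mathcal{B}$, let $L^iF$ denote its $i$-th left derived functor, and let $d=\sup\{i\ge 0\mid L^iF(M)\ne 0\}$. If $0\le d<\infty$, then $d=\sup\{i\ge 0\mid L^iF(N)\neq 0\}$. If moreover $0<d<\infty$, then $L^dF(H_0(P_\bullet))\cong L^dF(N)$. -/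

import Mathlib

open CategoryTheory CategoryTheory.Limits

universe v u v' u'

noncomputable section

namespace QuasiProj

variable {A : Type u} [Category.{v} A] [Abelian A]

attribute [local instance] Abelian.hasFiniteBiproducts

/-- `sup X = sup {i : ℤ | X_i ≠ 0}`, with value `⊥` (that is, `-∞`) if all terms vanish and `⊤`
(that is, `+∞`) if the set is unbounded. A `ChainComplex A ℤ` has differentials
`d_i : X_i ⟶ X_{i-1}`. -/
def sup (X : ChainComplex A ℤ) : EReal :=
  ⨆ (i : ℤ) (_ : ¬ IsZero (X.X i)), ((i : ℝ) : EReal)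

/-- The homological supremum `hsup X = sup {i : ℤ | H_i(X) ≠ 0}`. -/
def hsup (X : ChainComplex A ℤ) : EReal :=
  ⨆ (i : ℤ) (_ : ¬ IsZero (X.homology i)), ((i : ℝ) : EReal)

/-- Quasi-projective resolutions of `M`: complexes of projectives that are bounded below and whose
homology objects are finite direct sums `M^{n_j}`, where the `n_j` are not all zero. (In degrees
below the infimum of `P` the homology vanishes, which is `M^0`.) -/
structure IsQuasiProjectiveResolution (P : ChainComplex A ℤ) (M : A) : Prop where
  boundedBelow : ∃ a : ℤ, ∀ i < a, IsZero (P.X i)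
  projective : ∀ i : ℤ, Projective (P.X i)
  homology : ∃ n : ℤ → ℕ,
    (∀ j : ℤ, Nonempty (P.homology j ≅ ⨁ fun _ : Fin (n j) => M)) ∧ ∃ j : ℤ, n j ≠ 0

/-- A quasi-projective resolution is finite if it is also bounded above. -/
structure IsFiniteQuasiProjectiveResolution (P : ChainComplex A ℤ) (M : A) : Prop
    extends IsQuasiProjectiveResolution P M where
  boundedAbove : ∃ b : ℤ, ∀ i > b, IsZero (P.X i)

open Classical in
/-- The quasi-projective dimension: the infimum of `sup P - hsup P` over all finite quasi-projective
resolutions `P` of `M` (so `⊤` if there is none) for nonzero `M`, and `0` for zero objects. For a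
nonzero `M` both `sup P` and `hsup P` are integers. -/
def qpd (M : A) : EReal :=
  if IsZero M then 0
  else ⨅ (P : ChainComplex A ℤ) (_ : IsFiniteQuasiProjectiveResolution P M), sup P - hsup P

/-- `sup {i ≥ 0 | LⁱF(X) ≠ 0}`, with value `⊥` (that is, `-∞`) if all `LⁱF(X)` vanish and `⊤`
(that is, `+∞`) if infinitely many do not. -/
def leftDerivedSup {B : Type u'} [Category.{v'} B] [Abelian B] [EnoughProjectives A]
    (F : A ⥤ B) [F.Additive] (X : A) : EReal :=
  ⨆ (i : ℕ) (_ : ¬ IsZero ((F.leftDerived i).obj X)), ((i : ℝ) : EReal)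

end QuasiProj

end

-- Write resolutions cohomologically and shift them so that the lowest nonzero cohomology is `H^0`;
-- then `qpd M` is the least `p` for which some such "normalized" `K` vanishes below degree `-p`.
--
-- Terms in the given class `P`: in the derived category `K` is a finite iterated extension of the
-- shifts of sums `M^n`. The resolution of `M` by objects of `P` represents each shift. Bounded
-- above complexes over `P` are K-projective and closed under cones, so `K` is homotopy equivalent
-- to such a complex `L` (`map_Qh_of_homology`, `nonempty_iso_of_Qh_iso`). As `K` vanishes in degree
-- `-p - 1`, the opcycles of `L` in degree `-p` are a summand of a term of `L`, and truncating there
-- gives length `p` again.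
--
-- (a) The part of `K` in degrees `≤ 0` resolves `N = K.opcycles 0`. If `pd N` were less than `r`, a
-- syzygy would be projective earlier, and truncating there would give a normalized resolution
-- shorter than the minimal one.
--
-- (b) Compare `H^0 ⟶ K ⟶ τ≥1 K`. The third vertex is built from copies of `M` in degrees `i > 0`,
-- whose `F`-hyperhomology in degree `n` is `L_{i-n}F(M)`; this vanishes for `n ≤ -d`. Hence
-- `L_jF(H^0) ≅ H^{-j}(F K)` for `j ≥ d`, and the right side is `L_jF(N)` for `j > 0`. Since `H^0`
-- is a nonzero power of `M`, both claims follow; `d = 0` uses right exactness instead.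

universe w

open Pretriangulated ZeroObject

attribute [local instance] Abelian.hasFiniteBiproducts

open Pretriangulated

/-! ### Dévissage of bounded objects of the derived category by truncation -/

namespace DerivedCategory

variable {A : Type u} [Category.{v} A] [Abelian A] [HasDerivedCategory.{w} A]

lemma isIso_homologyMap_mor₁ {T : Triangle (DerivedCategory A)} (hT : T ∈ distTriang _) (i : ℤ)
    (h : IsZero ((homologyFunctor A (i - 1)).obj T.obj₃))
    (h' : IsZero ((homologyFunctor A i).obj T.obj₃)) :
    IsIso ((homologyFunctor A i).map T.mor₁) := by
  have : Mono ((homologyFunctor A i).map T.mor₁) :=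
    (HomologySequence.mono_homologyMap_mor₁_iff T hT (i - 1) i).2 (h.eq_of_src _ _)
  have : Epi ((homologyFunctor A i).map T.mor₁) :=
    (HomologySequence.epi_homologyMap_mor₁_iff T hT i).2 (h'.eq_of_tgt _ _)
  exact isIso_of_mono_of_epi _

lemma isIso_homologyMap_mor₂ {T : Triangle (DerivedCategory A)} (hT : T ∈ distTriang _) (i : ℤ)
    (h : IsZero ((homologyFunctor A i).obj T.obj₁))
    (h' : IsZero ((homologyFunctor A (i + 1)).obj T.obj₁)) :
    IsIso ((homologyFunctor A i).map T.mor₂) := by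
  have : Mono ((homologyFunctor A i).map T.mor₂) :=
    (HomologySequence.mono_homologyMap_mor₂_iff T hT i).2 (h.eq_of_src _ _)
  have : Epi ((homologyFunctor A i).map T.mor₂) :=
    (HomologySequence.epi_homologyMap_mor₂_iff T hT i (i + 1)).2 (h'.eq_of_tgt _ _)
  exact isIso_of_mono_of_epi _

/-- The truncation triangle `τ≤n X ⟶ X ⟶ τ≥(n+1) X` with its effect on homology. -/
lemma exists_truncation_triangle (X : DerivedCategory A) (n : ℤ) :
    ∃ (T : Triangle (DerivedCategory A)) (_ : T ∈ distTriang _) (_ : T.obj₂ = X),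
      T.obj₁.IsLE n ∧ T.obj₃.IsGE (n + 1) ∧
      (∀ i ≤ n, Nonempty ((homologyFunctor A i).obj T.obj₁ ≅ (homologyFunctor A i).obj X)) ∧
      (∀ i > n, Nonempty ((homologyFunctor A i).obj T.obj₃ ≅ (homologyFunctor A i).obj X)) := by
  obtain ⟨Y, Z, hY, hZ, f, g, h, hT⟩ := TStructure.t.exists_triangle X n (n + 1) rfl
  have hY' : Y.IsLE n := ⟨hY⟩
  have hZ' : Z.IsGE (n + 1) := ⟨hZ⟩
  refine ⟨_, hT, rfl, hY', hZ', fun i hi => ?_, fun i hi => ?_⟩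
  · have := isIso_homologyMap_mor₁ hT i (Z.isZero_of_isGE (n + 1) _ (by lia))
      (Z.isZero_of_isGE (n + 1) _ (by lia))
    exact ⟨@asIso _ _ _ _ _ this⟩
  · have := isIso_homologyMap_mor₂ hT i (Y.isZero_of_isLE n _ (by lia))
      (Y.isZero_of_isLE n _ (by lia))
    exact ⟨(@asIso _ _ _ _ _ this).symm⟩

/-- An object concentrated in degree `n` is the single object of its homology. -/
lemma nonempty_iso_single_homology (X : DerivedCategory A) (n : ℤ) [X.IsGE n] [X.IsLE n] :
    Nonempty (X ≅ (singleFunctor A n).obj ((homologyFunctor A n).obj X)) := by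
  obtain ⟨Y, ⟨e⟩⟩ := exists_iso_singleFunctor_obj_of_isGE_of_isLE X n
  have e' : (homologyFunctor A n).obj ((singleFunctor A n).obj Y) ≅ Y :=
    (homologyFunctor A n).mapIso ((singleFunctorIsoCompQ A n).app Y) ≪≫
      (homologyFunctorFactors A n).app _ ≪≫ HomologicalComplex.singleObjHomologySelfIso _ n Y
  exact ⟨e ≪≫ (singleFunctor A n).mapIso (e'.symm ≪≫ (homologyFunctor A n).mapIso e.symm)⟩

variable (T : ObjectProperty (DerivedCategory A)) [T.IsTriangulatedClosed₂]
    [T.IsClosedUnderIsomorphisms]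

/-- Dévissage: a bounded object belongs to any extension-closed class which contains
the shifts of its homology objects. -/
lemma prop_of_prop_single_homology [T.ContainsZero] (X : DerivedCategory A) (a b : ℤ)
    [hXa : X.IsGE a] [hXb : X.IsLE b]
    (h : ∀ i : ℤ, T ((singleFunctor A i).obj ((homologyFunctor A i).obj X))) : T X := by
  -- Induction on the number of degrees in `[a, b]`; with `a - 1`, the case `k = 0` is the empty
  -- range, where `X = 0`.
  obtain ⟨k, hk⟩ : ∃ k : ℕ, b ≤ a - 1 + k := ⟨(b - a + 1).toNat, by lia⟩
  induction k generalizing X a with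
  | zero =>
    have := TStructure.t.isLE_of_le X b (a - 1) (by lia)
    exact T.prop_of_isZero (TStructure.t.isZero X (a - 1) a)
  | succ k ih =>
    obtain ⟨S, hS, rfl, h₁, h₃, e₁, e₃⟩ := exists_truncation_triangle X a
    have h₁' : S.obj₁.IsGE a := by
      rw [isGE_iff]
      intro i hi
      exact (S.obj₂.isZero_of_isGE a i hi).of_iso (e₁ i hi.le).some
    have h₃' : S.obj₃.IsLE b := by
      rw [isLE_iff]
      intro i hi
      by_cases hia : a < i
      · exact (S.obj₂.isZero_of_isLE b i hi).of_iso (e₃ i hia).some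
      · exact S.obj₃.isZero_of_isGE (a + 1) i (by lia)
    refine T.ext_of_isTriangulatedClosed₂ S hS ?_ (ih S.obj₃ (a + 1) (fun i => ?_) (by lia))
    · exact T.prop_of_iso ((S.obj₁.nonempty_iso_single_homology a).some ≪≫
        (singleFunctor A a).mapIso (e₁ a le_rfl).some).symm (h a)
    · by_cases hia : a < i
      · exact T.prop_of_iso ((singleFunctor A i).mapIso (e₃ i hia).some).symm (h i)
      · exact T.prop_of_isZero ((singleFunctor A i).map_isZero
          (S.obj₃.isZero_of_isGE (a + 1) i (by lia)))

/-- A product is the middle vertex of the split triangle on its factors. -/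
lemma isClosedUnderBinaryProducts_of_isTriangulatedClosed₂ : T.IsClosedUnderBinaryProducts where
  limitsOfShape_le := by
    rintro X ⟨p⟩
    refine T.prop_of_iso ?_ (T.ext_of_isTriangulatedClosed₂ _
      (binaryProductTriangle_distinguished _ _)
      (p.prop_diag_obj (.mk .left)) (p.prop_diag_obj (.mk .right)))
    exact IsLimit.conePointUniqueUpToIso (prodIsProd _ _)
      ((IsLimit.postcomposeHomEquiv (diagramIsoPair p.diag) _).2 p.isLimit)

/-- Extension-closed classes are closed under finite direct sums of single objects. -/
lemma prop_single_biproduct [T.ContainsZero] (M : A) (i : ℤ)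
    (h : T ((singleFunctor A i).obj M)) (n : ℕ) :
    T ((singleFunctor A i).obj (⨁ fun _ : Fin n => M)) := by
  have := isClosedUnderBinaryProducts_of_isTriangulatedClosed₂ T
  have : T.IsClosedUnderFiniteProducts := .mk'
  exact T.prop_of_iso (PreservesProduct.iso (singleFunctor A i) (fun _ : Fin n => M)).symm
    (T.prop_product (fun _ => h)) |> T.prop_of_iso
      ((singleFunctor A i).mapIso (biproduct.isoProduct (fun _ : Fin n => M)).symm)

end DerivedCategory

/-! ### Bounded above complexes with terms in `P`: a triangulated class of K-projectives -/

namespace CochainComplex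

variable {A : Type u} [Category.{v} A] [Abelian A] (P : ObjectProperty A)

/-- Bounded above cochain complexes whose terms satisfy `P`. -/
def minusOf : ObjectProperty (CochainComplex A ℤ) :=
  fun K => (∃ n : ℤ, K.IsStrictlyLE n) ∧ ∀ i : ℤ, P (K.X i)

variable {P} in
lemma minusOf.isKProjective (hP : ∀ X : A, P X → Projective X) {K : CochainComplex A ℤ}
    (hK : minusOf P K) : K.IsKProjective := by
  obtain ⟨⟨n, _⟩, h⟩ := hK
  have (i : ℤ) : Projective (K.X i) := hP _ (h i)
  exact isKProjective_of_projective K n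

lemma minusOf_cochainComplex {P : ObjectProperty A} [P.IsClosedUnderFiniteCoproducts]
    [P.IsClosedUnderIsomorphisms]
    {M : A} (R : ProjectiveResolution M) (hR : ∀ i, P (R.complex.X i)) :
    minusOf P R.cochainComplex := by
  refine ⟨⟨0, inferInstance⟩, fun i => ?_⟩
  by_cases hi : i ≤ 0
  · obtain ⟨k, rfl⟩ := Int.exists_eq_neg_ofNat hi
    exact P.prop_of_iso (R.cochainComplexXIso (-k) k).symm (hR k)
  · exact P.prop_of_isInitial _ (isZero_of_isStrictlyLE _ 0 _).isInitial

end CochainComplex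

namespace HomotopyCategory

variable {A : Type u} [Category.{v} A] [Abelian A] (P : ObjectProperty A)

/-- Objects of the homotopy category whose underlying complex is bounded above with terms
satisfying `P`. -/
def minusOf : ObjectProperty (HomotopyCategory A (.up ℤ)) :=
  (CochainComplex.minusOf P).strictMap (quotient _ _)

variable {P} in
@[simp]
lemma minusOf_quotient_obj_iff (K : CochainComplex A ℤ) :
    minusOf P ((quotient _ _).obj K) ↔ CochainComplex.minusOf P K := by
  refine ⟨?_, fun h ↦ ⟨_, h⟩⟩
  simp only [minusOf, ObjectProperty.strictMap_iff]
  rintro ⟨L, h, hL⟩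
  obtain rfl : L = K := congr_arg Quotient.as hL
  exact h

lemma minusOf_le_leftOrthogonal (hP : ∀ X : A, P X → Projective X) :
    minusOf P ≤ (subcategoryAcyclic A).leftOrthogonal := by
  intro X hX
  obtain ⟨K, rfl⟩ := X.quotient_obj_surjective
  rw [minusOf_quotient_obj_iff] at hX
  have := hX.isKProjective hP
  exact CochainComplex.IsKProjective.leftOrthogonal K

instance [P.IsClosedUnderFiniteCoproducts] : (minusOf P).ContainsZero where
  exists_zero :=
    ⟨(quotient _ _).obj 0, Functor.map_isZero _ (isZero_zero _), by
      rw [minusOf_quotient_obj_iff]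
      refine ⟨⟨0, inferInstance⟩, fun i => ?_⟩
      exact P.prop_of_isInitial _
        ((HomologicalComplex.eval A (.up ℤ) i).map_isZero (isZero_zero _)).isInitial⟩

instance : (minusOf P).IsStableUnderShift ℤ where
  isStableUnderShiftBy n :=
    { le_shift K hK := by
        obtain ⟨K : CochainComplex _ _, rfl⟩ := K.quotient_obj_surjective
        simp only [minusOf_quotient_obj_iff] at hK
        obtain ⟨⟨q, _⟩, h⟩ := hK
        rw [ObjectProperty.prop_shift_iff, shift_quotient_obj, minusOf_quotient_obj_iff]
        exact ⟨⟨q - n, K.isStrictlyLE_shift q n (q - n) (by lia)⟩, fun i => h (i + n)⟩ }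

/-- The third vertex is homotopy equivalent to a mapping cone, whose terms are biproducts of terms
of the two given complexes. -/
instance [P.IsClosedUnderFiniteCoproducts] [P.IsClosedUnderIsomorphisms] :
    (minusOf P).IsTriangulatedClosed₃ where
  ext₃' T hT h₁ h₂ := by
    obtain ⟨⟨n₁, _⟩, h₁⟩ : (CochainComplex.minusOf P) T.obj₁.as := by
      rwa [← minusOf_quotient_obj_iff]
    obtain ⟨⟨n₂, _⟩, h₂⟩ : (CochainComplex.minusOf P) T.obj₂.as := by
      rwa [← minusOf_quotient_obj_iff]
    obtain ⟨f : T.obj₁.as ⟶ T.obj₂.as, hf⟩ := (quotient _ _).map_surjective T.mor₁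
    refine ⟨_, ?_,
      ⟨Triangle.π₃.mapIso (isoTriangleOfIso₁₂ T _ hT (mappingCone_triangleh_distinguished f)
        (Iso.refl _) (Iso.refl _) ?_)⟩⟩
    · change minusOf P ((quotient _ _).obj (CochainComplex.mappingCone f))
      rw [minusOf_quotient_obj_iff]
      refine ⟨⟨max n₁ n₂, ?_⟩, fun i => ?_⟩
      · rw [CochainComplex.isStrictlyLE_iff]
        intro i hi
        rw [CochainComplex.mappingCone.isZero_X_iff]
        exact ⟨CochainComplex.isZero_of_isStrictlyLE _ n₁ _ (by lia),
          CochainComplex.isZero_of_isStrictlyLE _ n₂ _ (by lia)⟩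
      · exact P.prop_of_iso (HomologicalComplex.homotopyCofiber.XIsoBiprod f i (i + 1) rfl).symm
          (P.prop_of_isColimit_binaryCofan (BinaryBiproduct.isColimit _ _) (h₁ _) (h₂ _))
    · change T.mor₁ ≫ 𝟙 _ = 𝟙 _ ≫ (quotient _ _).map f
      rw [Category.comp_id, Category.id_comp, hf]

instance [P.IsClosedUnderFiniteCoproducts] [P.IsClosedUnderIsomorphisms] :
    (minusOf P).IsTriangulated where
  toIsTriangulatedClosed₂ := .of_isTriangulatedClosed₃

end HomotopyCategory

/-! ### Lifting from the derived category to the homotopy category -/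

namespace DerivedCategory

variable {A : Type u} [Category.{v} A] [Abelian A] [HasDerivedCategory.{w} A]

lemma Qh_map_bijective_of_leftOrthogonal {X : HomotopyCategory A (.up ℤ)}
    (hX : (HomotopyCategory.subcategoryAcyclic A).leftOrthogonal X)
    (Y : HomotopyCategory A (.up ℤ)) :
    Function.Bijective (Qh.map : (X ⟶ Y) → _) :=
  hX.map_bijective_of_isTriangulated _ _

lemma nonempty_iso_of_Qh_iso {X Y : HomotopyCategory A (.up ℤ)}
    (hX : (HomotopyCategory.subcategoryAcyclic A).leftOrthogonal X)
    (hY : (HomotopyCategory.subcategoryAcyclic A).leftOrthogonal Y)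
    (e : Qh.obj X ≅ Qh.obj Y) : Nonempty (X ≅ Y) := by
  obtain ⟨f, hf⟩ := (Qh_map_bijective_of_leftOrthogonal hX Y).surjective e.hom
  obtain ⟨g, hg⟩ := (Qh_map_bijective_of_leftOrthogonal hY X).surjective e.inv
  exact ⟨f, g, (Qh_map_bijective_of_leftOrthogonal hX X).injective (by simp [hf, hg]),
    (Qh_map_bijective_of_leftOrthogonal hY Y).injective (by simp [hf, hg])⟩

/-- A distinguished triangle of the derived category whose outer vertices come from K-projective
objects lifts to the homotopy category. -/
lemma exists_lift_triangle {T : Triangle (DerivedCategory A)} (hT : T ∈ distTriang _)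
    {X₁ X₃ : HomotopyCategory A (.up ℤ)}
    (hX₃ : (HomotopyCategory.subcategoryAcyclic A).leftOrthogonal X₃)
    (e₁ : Qh.obj X₁ ≅ T.obj₁) (e₃ : Qh.obj X₃ ≅ T.obj₃) :
    ∃ (X₂ : HomotopyCategory A (.up ℤ)) (f : X₁ ⟶ X₂) (g : X₂ ⟶ X₃) (h : X₃ ⟶ X₁⟦(1 : ℤ)⟧),
      Triangle.mk f g h ∈ distTriang _ ∧ Nonempty (Qh.obj X₂ ≅ T.obj₂) := by
  -- The connecting morphism determines the triangle up to isomorphism and has source `X₃`, so only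
  -- `X₃` has to be K-projective for it to lift.
  obtain ⟨h, hh⟩ := (Qh_map_bijective_of_leftOrthogonal hX₃ (X₁⟦(1 : ℤ)⟧)).surjective
    (e₃.hom ≫ T.mor₃ ≫ e₁.inv⟦(1 : ℤ)⟧' ≫ (Qh.commShiftIso (1 : ℤ)).inv.app X₁)
  obtain ⟨X₂, f, g, hD⟩ := distinguished_cocone_triangle₂ h
  refine ⟨X₂, f, g, h, hD, ?_⟩
  exact ⟨Triangle.π₂.mapIso (isoTriangleOfIso₁₃ _ _ (Qh.map_distinguished _ hD) hT e₁ e₃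
    (by
      change (Qh.map h ≫ (Qh.commShiftIso (1 : ℤ)).hom.app X₁) ≫ e₁.hom⟦(1 : ℤ)⟧' =
        e₃.hom ≫ T.mor₃
      simp [hh, ← Functor.map_comp]))⟩

lemma isTriangulatedClosed₂_map_Qh (T : ObjectProperty (HomotopyCategory A (.up ℤ)))
    [T.IsTriangulatedClosed₂]
    (hT : T ≤ (HomotopyCategory.subcategoryAcyclic A).leftOrthogonal) :
    (T.map (Qh (C := A))).IsTriangulatedClosed₂ := by
  refine .mk' fun S hS h₁ h₃ => ?_
  simp only [ObjectProperty.prop_map_iff] at h₁ h₃ ⊢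
  obtain ⟨X₁, h₁, ⟨e₁⟩⟩ := h₁
  obtain ⟨X₃, h₃, ⟨e₃⟩⟩ := h₃
  obtain ⟨X₂, f, g, h, hD, ⟨e₂⟩⟩ := exists_lift_triangle hS (hT _ h₃) e₁ e₃
  obtain ⟨Y, hY, ⟨e⟩⟩ := T.ext_of_isTriangulatedClosed₂' _ hD h₁ h₃
  exact ⟨Y, hY, ⟨Qh.mapIso e.symm ≪≫ e₂⟩⟩

/-- Dévissage in the homotopy category: a cohomologically bounded object, all of whose homology
objects have resolutions in an extension-closed class `T` of K-projective objects (placed in the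
appropriate degree), has a resolution in `T`. -/
lemma map_Qh_of_homology (T : ObjectProperty (HomotopyCategory A (.up ℤ)))
    [T.IsTriangulatedClosed₂] [T.ContainsZero]
    (hT : T ≤ (HomotopyCategory.subcategoryAcyclic A).leftOrthogonal)
    (X : DerivedCategory A) (a b : ℤ) [X.IsGE a] [X.IsLE b] (M : A)
    (h : ∀ i : ℤ, IsZero ((homologyFunctor A i).obj X) ∨
      ((∃ n : ℕ, Nonempty ((homologyFunctor A i).obj X ≅ ⨁ fun _ : Fin n => M)) ∧
      T.map (Qh (C := A)) ((singleFunctor A i).obj M))) :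
    T.map (Qh (C := A)) X := by
  have := isTriangulatedClosed₂_map_Qh T hT
  have : (T.map (Qh (C := A))).ContainsZero := by
    obtain ⟨Z, hZ, h⟩ := T.exists_prop_of_containsZero
    exact ⟨Qh.obj Z, Qh.map_isZero hZ, T.prop_map_obj _ h⟩
  refine prop_of_prop_single_homology _ X a b fun i => ?_
  obtain hi | ⟨⟨n, ⟨e⟩⟩, hi⟩ := h i
  · exact ObjectProperty.prop_of_isZero _ ((singleFunctor A i).map_isZero hi)
  · exact ObjectProperty.prop_of_iso _ ((singleFunctor A i).mapIso e.symm)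
      (prop_single_biproduct _ M i hi n)

/-- The single object of `M` in degree `i` is represented by the shifted resolution. -/
lemma nonempty_Qh_resolution_shift_iso {M : A} (R : ProjectiveResolution M) (i : ℤ) :
    Nonempty (Qh.obj (((HomotopyCategory.quotient A (.up ℤ)).obj R.cochainComplex)⟦-i⟧) ≅
      (singleFunctor A i).obj M) :=
  ⟨(Qh.commShiftIso (-i)).app _ ≪≫
    (shiftFunctor (DerivedCategory A) (-i)).mapIso
      ((quotientCompQhIso A).app _ ≪≫ asIso (Q.map R.π') ≪≫
        ((singleFunctorIsoCompQ A 0).app M).symm) ≪≫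
    ((singleFunctors A).shiftIso (-i) i 0 (by lia)).app M⟩

end DerivedCategory

/-! ### Opcycles as syzygies, and truncation -/

namespace CochainComplex

variable {A : Type u} [Category.{v} A] [Abelian A]

/-- If `L` is homotopy equivalent to a complex which vanishes in degree `n - 1`, then the
opcycles of `L` in degree `n` are a direct summand of `L.X n`. -/
lemma nonempty_retract_opcycles {K L : CochainComplex A ℤ} (e : HomotopyEquiv L K) (n : ℤ)
    (hK : IsZero (K.X (n - 1))) : Nonempty (Retract (L.opcycles n) (L.X n)) := by
  let h := e.homotopyHomInvId
  have h₁ : (e.hom ≫ e.inv).f (n - 1) = 0 := by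
    rw [HomologicalComplex.comp_f, hK.eq_of_tgt (e.hom.f (n - 1)) 0, zero_comp]
  have h₂ := h.comm (n - 1)
  rw [h₁, dNext_eq h.hom (i' := n) (by simp), prevD_eq h.hom (j' := n - 2) (by simp; ring),
    HomologicalComplex.id_f] at h₂
  have h₃ : L.d (n - 1) n ≫ (h.hom n (n - 1) ≫ L.d (n - 1) n + 𝟙 _) = 0 := by
    have := congr($h₂ ≫ L.d (n - 1) n)
    simp only [zero_comp, Preadditive.add_comp, Category.assoc, HomologicalComplex.d_comp_d,
      comp_zero, add_zero, Category.id_comp] at this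
    simpa using this.symm
  -- By `h₃`, `h d + 1` factors through the opcycles; since `d ≫ pOpcycles = 0`, following it by
  -- `pOpcycles` gives the identity.
  refine ⟨⟨L.descOpcycles _ (n - 1) (by simp) h₃, L.pOpcycles n, ?_⟩⟩
  rw [← cancel_epi (L.pOpcycles n)]
  simp

lemma exists_shortExact_opcycles (K : CochainComplex A ℤ) (i j : ℤ) (hij : i + 1 = j)
    (hK : K.ExactAt i) :
    ∃ S : ShortComplex A, S.ShortExact ∧ S.X₁ = K.opcycles i ∧ S.X₂ = K.X j ∧
      S.X₃ = K.opcycles j := by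
  let S : ShortComplex A := ShortComplex.mk (K.fromOpcycles i j) (K.pOpcycles j) (by
    rw [← cancel_epi (K.pOpcycles i)]; simp)
  have : Mono S.f := by
    have := (K.exactAt_iff i).1 hK
    obtain rfl : j = (ComplexShape.up ℤ).next i := by simp [hij]
    exact this.mono_fromOpcycles
  have hS : S.Exact := by
    let S' := ShortComplex.mk (K.d i j) (K.pOpcycles j) (by simp)
    let φ : S' ⟶ S := { τ₁ := K.pOpcycles i, τ₂ := 𝟙 _, τ₃ := 𝟙 _ }
    have : Epi φ.τ₁ := inferInstanceAs (Epi (K.pOpcycles i))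
    have : IsIso φ.τ₂ := inferInstanceAs (IsIso (𝟙 _))
    have : Mono φ.τ₃ := inferInstanceAs (Mono (𝟙 _))
    exact (ShortComplex.exact_iff_of_epi_of_isIso_of_mono φ).1
      (S'.exact_of_g_is_cokernel (K.opcyclesIsCokernel i j (by simp [← hij])))
  exact ⟨S, { exact := hS }, rfl, rfl, rfl⟩

/-- The truncation keeps the terms above `n`, has the opcycles in degree `n`, and is zero below. -/
lemma minusOf_truncGE {K : CochainComplex A ℤ} {P : ObjectProperty A}
    [P.IsClosedUnderFiniteCoproducts] [P.IsClosedUnderIsomorphisms] (hK : minusOf P K) (n : ℤ) (hn : P (K.opcycles n)) :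
    minusOf P (K.truncGE n) := by
  obtain ⟨⟨b, _⟩, h⟩ := hK
  refine ⟨⟨b, inferInstance⟩, fun i => ?_⟩
  obtain hi | rfl | hi := lt_trichotomy i n
  · exact P.prop_of_isInitial _ ((K.truncGE n).isZero_of_isStrictlyGE n i hi).isInitial
  · exact P.prop_of_iso (K.truncGEXIsoOpcycles i).symm hn
  · exact P.prop_of_iso (K.truncGEXIso n i hi).symm (h i)

variable {K : CochainComplex A ℤ} [∀ i, Projective (K.X i)] [K.IsGE 0]

/-- Dimension shifting: exactness in negative degrees makes `K.opcycles (-p)` a `p`-th syzygy of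
`K.opcycles 0`. -/
lemma hasProjectiveDimensionLT_opcycles_iff (p k : ℕ) :
    HasProjectiveDimensionLT (K.opcycles 0) (p + k + 1) ↔
      HasProjectiveDimensionLT (K.opcycles (-p)) (k + 1) := by
  induction p generalizing k with
  | zero => simp
  | succ p ih =>
    rw [show p + 1 + k + 1 = p + (k + 1) + 1 by ring, ih]
    obtain ⟨S, hS, h₁, h₂, h₃⟩ := K.exists_shortExact_opcycles (-(p + 1 : ℕ)) (-p)
      (by push_cast; ring)
      (K.exactAt_of_isGE 0 _ (by lia))
    rw [← h₁, ← h₃]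
    exact hS.hasProjectiveDimensionLT_X₃_iff k (h₂ ▸ inferInstance)

/-- The left half of a complex of projectives which is exact in negative degrees is a projective
resolution of the cokernel of its last differential. -/
noncomputable def resolutionOfIsGE {N : A} (p : K.X 0 ⟶ N) (w : K.d (-1) 0 ≫ p = 0) [Epi p]
    (hp : (ShortComplex.mk _ _ w).Exact) : ProjectiveResolution N where
  complex := K.restriction ComplexShape.embeddingDownNat
  projective i := inferInstanceAs (Projective (K.X _))
  π := (ChainComplex.toSingle₀Equiv _ _).symm ⟨p, w⟩
  quasiIso := ⟨fun n => by
    obtain _ | n := n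
    · have hπ : ((ChainComplex.toSingle₀Equiv (K.restriction ComplexShape.embeddingDownNat)
          N).symm ⟨p, w⟩).f 0 = p :=
        ChainComplex.toSingle₀Equiv_symm_apply_f_zero
          (C := K.restriction ComplexShape.embeddingDownNat) (X := N) p w
      rw [ChainComplex.quasiIsoAt₀_iff, ShortComplex.quasiIso_iff_of_zeros']
      · refine (ShortComplex.exact_and_epi_g_iff_of_iso ?_).2 ⟨hp, by assumption⟩
        exact ShortComplex.isoMk (Iso.refl _) (Iso.refl _) (Iso.refl _)
          ((Category.id_comp _).trans (Category.comp_id _).symm)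
          ((Category.id_comp _).trans (hπ.symm.trans (Category.comp_id _).symm))
      · exact (K.restriction ComplexShape.embeddingDownNat).shape 0 0 (by simp)
      all_goals rfl
    · rw [quasiIsoAt_iff_exactAt']
      · rw [HomologicalComplex.exactAt_iff_isZero_homology]
        exact (K.isZero_of_isGE 0 (-(n + 1 : ℕ))).of_iso
          (K.restrictionHomologyIso ComplexShape.embeddingDownNat (n + 2) (n + 1) n (by simp)
            (by simp) (i' := -(n + 2 : ℕ)) (j' := -(n + 1 : ℕ)) (k' := -(n : ℕ)) (by simp)
            (by simp) (by simp) (by simp; ring) (by simp))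
      · exact ChainComplex.exactAt_succ_single_obj _ _⟩

end CochainComplex

/-! ### Hyperhomology of a termwise applied additive functor -/

section

variable {A : Type u} [Category.{v} A] [Abelian A] {B : Type u'} [Category.{v'} B] [Abelian B]
  (F : A ⥤ B) [F.Additive]

/-- Additive functors commute with extension by zero of complexes. -/
lemma HomologicalComplex.nonempty_mapExtendIso {ι ι' : Type*} {c : ComplexShape ι}
    {c' : ComplexShape ι'} (K : HomologicalComplex A c) (e : c.Embedding c') :
    Nonempty ((F.mapHomologicalComplex c').obj (K.extend e) ≅
      ((F.mapHomologicalComplex c).obj K).extend e) := by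
  have h₀ (i' : ι') (hi : ∀ i, e.f i ≠ i') : IsZero (F.obj ((K.extend e).X i')) :=
    F.map_isZero (K.isZero_extend_X e i' hi)
  obtain ⟨ψ, hψ⟩ : ∃ ψ : ∀ (i : ι) (i' : ι') (_ : e.f i = i'), F.obj (K.X i) ≅
      (((F.mapHomologicalComplex c).obj K).extend e).X i',
      ∀ (i j : ι) (i' j' : ι') (hi : e.f i = i') (hj : e.f j = j'),
        (((F.mapHomologicalComplex c).obj K).extend e).d i' j' =
          (ψ i i' hi).inv ≫ F.map (K.d i j) ≫ (ψ j j' hj).hom :=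
    ⟨fun i i' hi => (((F.mapHomologicalComplex c).obj K).extendXIso e hi).symm,
      fun i j i' j' hi hj => extend_d_eq _ e hi hj⟩
  -- Off the image of `e` both objects are zero, so no condition on `φ` is needed there.
  have h (i' : ι') : ∃ φ : F.obj ((K.extend e).X i') ≅
      (((F.mapHomologicalComplex c).obj K).extend e).X i', ∀ (i : ι) (hi : e.f i = i'),
        φ.hom = F.map (K.extendXIso e hi).hom ≫ (ψ i i' hi).hom := by
    by_cases hi : ∃ i, e.f i = i'
    · obtain ⟨i, rfl⟩ := hi
      refine ⟨F.mapIso (K.extendXIso e rfl) ≪≫ ψ i _ rfl, fun j hj => ?_⟩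
      obtain rfl := e.injective_f hj
      rfl
    · push Not at hi
      exact ⟨(h₀ i' hi).iso (isZero_extend_X _ _ _ hi), fun i hi' => (hi i hi').elim⟩
  choose φ hφ using h
  refine ⟨Hom.isoOfComponents φ fun i' j' _ => ?_⟩
  by_cases hi : ∃ i, e.f i = i'
  · obtain ⟨i, hi⟩ := hi
    by_cases hj : ∃ j, e.f j = j'
    · obtain ⟨j, hj⟩ := hj
      rw [hφ i' i hi, hφ j' j hj, hψ i j i' j' hi hj]
      change _ = F.map ((K.extend e).d i' j') ≫ _
      rw [extend_d_eq _ e hi hj]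
      simp only [Functor.map_comp, Category.assoc, Iso.map_inv_hom_id_assoc]
      exact (Category.assoc _ _ _).trans (congrArg _ ((ψ i i' hi).hom_inv_id_assoc _))
    · push Not at hj
      exact (isZero_extend_X _ _ _ hj).eq_of_tgt _ _
  · push Not at hi
    exact (h₀ i' hi).eq_of_src _ _

namespace HomotopyCategory

/-- The hyperhomology in degree `n` of the termwise application of `F`. -/
noncomputable def mapHomology (n : ℤ) : HomotopyCategory A (.up ℤ) ⥤ B :=
  F.mapHomotopyCategory (.up ℤ) ⋙ homologyFunctor B (.up ℤ) n

instance (n : ℤ) : (mapHomology F n).IsHomological := by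
  dsimp only [mapHomology]
  infer_instance

noncomputable def mapHomologyQuotientObjIso (n : ℤ) (K : CochainComplex A ℤ) :
    (mapHomology F n).obj ((quotient _ _).obj K) ≅
      ((F.mapHomologicalComplex (.up ℤ)).obj K).homology n :=
  (homologyFunctorFactors B (.up ℤ) n).app ((F.mapHomologicalComplex (.up ℤ)).obj K)

noncomputable def mapHomologyShiftIso (X : HomotopyCategory A (.up ℤ)) (n a m : ℤ)
    (h : n + a = m) :
    (mapHomology F a).obj (X⟦n⟧) ≅ (mapHomology F m).obj X :=
  (homologyFunctor B (.up ℤ) a).mapIso (((F.mapHomotopyCategory (.up ℤ)).commShiftIso n).app X) ≪≫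
    ((homologyFunctor B (.up ℤ) 0).shiftIso n a m h).app _

lemma mapHomology_isZero_of_distTriang {T : Triangle (HomotopyCategory A (.up ℤ))}
    (hT : T ∈ distTriang _) (n : ℤ) (h₁ : IsZero ((mapHomology F n).obj T.obj₁))
    (h₃ : IsZero ((mapHomology F n).obj T.obj₃)) : IsZero ((mapHomology F n).obj T.obj₂) :=
  ((mapHomology F n).map_distinguished_exact T hT).isZero_of_both_zeros
    (h₁.eq_of_src _ _) (h₃.eq_of_tgt _ _)

lemma isIso_mapHomology_mor₁ {T : Triangle (HomotopyCategory A (.up ℤ))}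
    (hT : T ∈ distTriang _) (n : ℤ) (h : IsZero ((mapHomology F (n - 1)).obj T.obj₃))
    (h' : IsZero ((mapHomology F n).obj T.obj₃)) :
    IsIso ((mapHomology F n).map T.mor₁) := by
  have : Epi ((mapHomology F n).map T.mor₁) :=
    ((mapHomology F n).map_distinguished_exact T hT).epi_f (h'.eq_of_tgt _ _)
  -- In the inverse rotated triangle the map preceding `mor₁` starts at `obj₃⟦-1⟧`, whose
  -- hyperhomology in degree `n` is that of `obj₃` in degree `n - 1`.
  have : Mono ((mapHomology F n).map T.mor₁) :=
    ((mapHomology F n).map_distinguished_exact _ (inv_rot_of_distTriang _ hT)).mono_g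
      ((h.of_iso (mapHomologyShiftIso F T.obj₃ (-1) n (n - 1) (by ring))).eq_of_src _ _)
  exact isIso_of_mono_of_epi _

/-- This and the next two instances make vanishing of hyperhomology in prescribed degrees a property
to which dévissage applies. -/
instance instIsClosedUnderIsomorphismsMapHomology (S : Set ℤ) :
    ObjectProperty.IsClosedUnderIsomorphisms
    (fun X : HomotopyCategory A (.up ℤ) => ∀ n ∈ S, IsZero ((mapHomology F n).obj X)) where
  of_iso e h n hn := (h n hn).of_iso ((mapHomology F n).mapIso e.symm)

instance instIsTriangulatedClosed₂MapHomology (S : Set ℤ) : ObjectProperty.IsTriangulatedClosed₂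
    (fun X : HomotopyCategory A (.up ℤ) => ∀ n ∈ S, IsZero ((mapHomology F n).obj X)) :=
  .mk' fun _ hT h₁ h₃ n hn => mapHomology_isZero_of_distTriang F hT n (h₁ n hn) (h₃ n hn)

instance instContainsZeroMapHomology (S : Set ℤ) : ObjectProperty.ContainsZero
    (fun X : HomotopyCategory A (.up ℤ) => ∀ n ∈ S, IsZero ((mapHomology F n).obj X)) where
  exists_zero := ⟨0, isZero_zero _, fun n _ => (mapHomology F n).map_isZero (isZero_zero _)⟩

end HomotopyCategory

open HomotopyCategory

variable [EnoughProjectives A]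

lemma CategoryTheory.ProjectiveResolution.nonempty_leftDerived_iso_mapHomology {M : A}
    (R : ProjectiveResolution M) (j : ℕ) (n : ℤ) (hn : -(j : ℤ) = n) :
    Nonempty ((F.leftDerived j).obj M ≅
      (mapHomology F n).obj ((quotient _ _).obj R.cochainComplex)) := by
  obtain ⟨e⟩ := HomologicalComplex.nonempty_mapExtendIso F R.complex ComplexShape.embeddingDownNat
  exact ⟨R.isoLeftDerivedObj F j ≪≫
    (((F.mapHomologicalComplex _).obj R.complex).extendHomologyIso
      ComplexShape.embeddingDownNat (j' := n) (by simpa using hn)).symm ≪≫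
    (HomologicalComplex.homologyFunctor B _ n).mapIso e.symm ≪≫
    (mapHomologyQuotientObjIso F n _).symm⟩

end

/-! ### Normalized resolutions: minimal length, and replacement of the terms -/

namespace QuasiProj

open HomotopyCategory

variable {A : Type u} [Category.{v} A] [Abelian A]

instance isClosedUnderFiniteCoproducts_isProjective :
    (isProjective A).IsClosedUnderFiniteCoproducts where
  isClosedUnderColimitsOfShape J _ := ⟨by
    rintro X ⟨p⟩
    have := p.prop_diag_obj
    refine ⟨fun f g _ => ⟨p.isColimit.desc (Cocone.mk _ (Discrete.natTrans fun j =>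
      Projective.factorThru (P := p.diag.obj j) (p.ι.app j ≫ f) g)),
      p.isColimit.hom_ext fun j => ?_⟩⟩
    rw [p.isColimit.fac_assoc]
    exact Projective.factorThru_comp _ _⟩

instance isClosedUnderIsomorphisms_isProjective : (isProjective A).IsClosedUnderIsomorphisms where
  of_iso e h := Projective.of_iso e h

/-- A quasi-projective resolution of `M`, written cohomologically and shifted so that the lowest
nonzero cohomology object sits in degree `0`. -/
structure IsNormalizedResolution (K : CochainComplex A ℤ) (M : A) : Prop where
  boundedAbove : ∃ b : ℤ, K.IsStrictlyLE b
  projective : ∀ i : ℤ, Projective (K.X i)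
  isGE : K.IsGE 0
  homology : ∃ n : ℤ → ℕ,
    (∀ i : ℤ, Nonempty (K.homology i ≅ ⨁ fun _ : Fin (n i) => M)) ∧ n 0 ≠ 0

namespace IsNormalizedResolution

variable {K : CochainComplex A ℤ} {M : A}

lemma minusOf_isProjective (hK : IsNormalizedResolution K M) :
    CochainComplex.minusOf (isProjective A) K :=
  ⟨hK.boundedAbove, hK.projective⟩

lemma not_isZero_homology_zero (hK : IsNormalizedResolution K M) (hM : ¬ IsZero M) :
    ¬ IsZero (K.homology 0) := by
  obtain ⟨n, e, h0⟩ := hK.homology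
  intro h
  have : NeZero (n 0) := ⟨h0⟩
  exact hM (((h.of_iso (e 0).some.symm).of_mono (biproduct.ι (fun _ : Fin (n 0) => M) 0)))

lemma of_homology_iso (hK : IsNormalizedResolution K M) {L : CochainComplex A ℤ}
    (hb : ∃ b : ℤ, L.IsStrictlyLE b) (hL : ∀ i : ℤ, Projective (L.X i))
    (e : ∀ i, Nonempty (L.homology i ≅ K.homology i)) : IsNormalizedResolution L M where
  boundedAbove := hb
  projective := hL
  isGE := by
    have := hK.isGE
    rw [CochainComplex.isGE_iff]
    intro i hi
    rw [HomologicalComplex.exactAt_iff_isZero_homology]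
    exact (K.isZero_of_isGE 0 i hi).of_iso (e i).some
  homology := by
    obtain ⟨n, e', h0⟩ := hK.homology
    exact ⟨n, fun i => ⟨(e i).some ≪≫ (e' i).some⟩, h0⟩

/-- All cohomology sits in degrees `≥ 0 ≥ -p`, so truncating at `-p` does not change it. -/
lemma truncGE (hK : IsNormalizedResolution K M) (p : ℕ) (hp : Projective (K.opcycles (-p))) :
    IsNormalizedResolution (K.truncGE (-p)) M := by
  have := hK.isGE
  have := K.isGE_of_ge (-p) 0 (by lia)
  have h := CochainComplex.minusOf_truncGE hK.minusOf_isProjective (-p) hp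
  exact hK.of_homology_iso h.1 h.2 fun i =>
    ⟨(asIso (HomologicalComplex.homologyMap (K.πTruncGE (-p)) i)).symm⟩

lemma projective_opcycles (hK : IsNormalizedResolution K M) (p : ℕ)
    [K.IsStrictlyGE (-p)] : Projective (K.opcycles (-p)) := by
  have := hK.projective (-p)
  have h : IsIso (K.pOpcycles (-p)) :=
    K.isIso_pOpcycles (-p - 1) (-p) (by simp)
      ((K.isZero_of_isStrictlyGE (-p) (-p - 1) (by lia)).eq_of_src _ _)
  exact Projective.of_iso (asIso (K.pOpcycles (-p))) inferInstance

/-- The projective dimension of the cokernel in degree `0` is the length of a normalized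
resolution of minimal length. -/
lemma projectiveDimension_opcycles (hK : IsNormalizedResolution K M) (hM : ¬ IsZero M) (r : ℕ)
    (hr : K.IsStrictlyGE (-r))
    (hmin : ∀ (p : ℕ) (L : CochainComplex A ℤ), IsNormalizedResolution L M →
      L.IsStrictlyGE (-p) → r ≤ p) :
    projectiveDimension (K.opcycles 0) = (r : WithBot ℕ∞) := by
  have := hK.projective
  have := hK.isGE
  apply le_antisymm
  · have := hK.projective_opcycles r
    exact (projectiveDimension_le_iff _ _).2
      ((CochainComplex.hasProjectiveDimensionLT_opcycles_iff r 0).2 inferInstance)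
  · refine (projectiveDimension_ge_iff _ _).2 fun h => ?_
    -- For `r = 0` the cokernel would be zero, although it contains `H^0`. For `r = p + 1` the
    -- opcycles in degree `-p` would be projective, and truncation there would have length `p < r`.
    obtain _ | p := r
    · exact hK.not_isZero_homology_zero hM
        ((isZero_of_hasProjectiveDimensionLT_zero _).of_mono (K.homologyι 0))
    · have h' := (CochainComplex.hasProjectiveDimensionLT_opcycles_iff p 0).1 h
      have := hmin p _ (hK.truncGE p (projective_iff_hasProjectiveDimensionLT_one.2 h'))
        inferInstance
      lia

lemma map_Qh_single [HasDerivedCategory.{w} A]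
    (T : ObjectProperty (HomotopyCategory A (.up ℤ)))
    (R : ProjectiveResolution M) (i : ℤ)
    (h : T (((quotient A (.up ℤ)).obj R.cochainComplex)⟦-i⟧)) :
    T.map (DerivedCategory.Qh (C := A)) ((DerivedCategory.singleFunctor A i).obj M) :=
  (ObjectProperty.prop_map_iff _ _ _).2
    ⟨_, h, DerivedCategory.nonempty_Qh_resolution_shift_iso R i⟩

/-- If `M` has a projective resolution with terms satisfying `P`, then a normalized resolution
of `M` can be replaced by one of the same length with terms satisfying `P`. -/
lemma exists_minusOf {P : ObjectProperty A} (hP : ∀ X : A, P X → Projective X)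
    [P.IsStableUnderRetracts] [P.IsClosedUnderFiniteCoproducts]
    (R : ProjectiveResolution M) (hR : ∀ i : ℕ, P (R.complex.X i))
    (hK : IsNormalizedResolution K M) (p : ℕ) [K.IsStrictlyGE (-p)] :
    ∃ L : CochainComplex A ℤ, CochainComplex.minusOf P L ∧ IsNormalizedResolution L M ∧
      L.IsStrictlyGE (-p) := by
  let _ := HasDerivedCategory.standard A
  have := hK.isGE
  obtain ⟨b, _⟩ := hK.boundedAbove
  obtain ⟨X, hX, ⟨e⟩⟩ := (ObjectProperty.prop_map_iff _ _ _).1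
    (DerivedCategory.map_Qh_of_homology (minusOf P) (minusOf_le_leftOrthogonal P hP)
      (DerivedCategory.Q.obj K) 0 b M fun i => Or.inr (by
        obtain ⟨n, e, -⟩ := hK.homology
        refine ⟨⟨n i, ⟨(DerivedCategory.homologyFunctorFactors A i).app K ≪≫ (e i).some⟩⟩,
          map_Qh_single _ R i ?_⟩
        exact ObjectProperty.le_shift (minusOf P) (-i) _
          ((minusOf_quotient_obj_iff _).2 (CochainComplex.minusOf_cochainComplex R hR))))
  obtain ⟨L, rfl⟩ := X.quotient_obj_surjective
  rw [minusOf_quotient_obj_iff] at hX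
  -- Both complexes are K-projective, so the isomorphism in the derived category is a homotopy
  -- equivalence.
  obtain ⟨e'⟩ := DerivedCategory.nonempty_iso_of_Qh_iso
    (minusOf_le_leftOrthogonal P hP _ ((minusOf_quotient_obj_iff L).2 hX))
    (minusOf_le_leftOrthogonal _ (fun _ h => h) _
      ((minusOf_quotient_obj_iff K).2 hK.minusOf_isProjective))
    (e ≪≫ ((DerivedCategory.quotientCompQhIso A).app K).symm)
  have hL : IsNormalizedResolution L M := hK.of_homology_iso hX.1 (fun i => hP _ (hX.2 i))
    fun i => ⟨((homologyFunctorFactors A (.up ℤ) i).app L).symm ≪≫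
      (homologyFunctor A (.up ℤ) i).mapIso e' ≪≫ (homologyFunctorFactors A (.up ℤ) i).app K⟩
  obtain ⟨h⟩ := CochainComplex.nonempty_retract_opcycles (homotopyEquivOfIso e') (-(p : ℤ))
    (K.isZero_of_isStrictlyGE (-(p : ℤ)) _ (by lia))
  have h' := P.prop_of_retract h (hX.2 _)
  exact ⟨CochainComplex.truncGE L (-p), CochainComplex.minusOf_truncGE hX _ h',
    hL.truncGE p (hP _ h'),
    inferInstance⟩

end IsNormalizedResolution

end QuasiProj

/-! ### Left derived functors at the lowest homology and at the cokernel -/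

section

variable {A : Type u} [Category.{v} A] [Abelian A]
  {B : Type u'} [Category.{v'} B] [Abelian B] (F : A ⥤ B) [F.Additive]

/-- By right exactness `F.obj (K.opcycles 0)` is the cokernel of `F.map (K.d (-1) 0)`. If it
vanishes, that map is epi, which forces the next differential to be zero. -/
lemma QuasiProj.isZero_mapHomology_zero [PreservesFiniteColimits F] (K : CochainComplex A ℤ)
    (h : IsZero (F.obj (K.opcycles 0))) :
    IsZero ((HomotopyCategory.mapHomology F 0).obj ((HomotopyCategory.quotient _ _).obj K)) := by
  refine IsZero.of_iso ?_ (HomotopyCategory.mapHomologyQuotientObjIso F 0 K)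
  have : Epi (F.map (K.d (-1) 0)) := Preadditive.epi_of_isZero_cokernel' _
    (CokernelCofork.mapIsColimit _ (K.opcyclesIsCokernel (-1) 0 (by simp)) F) h
  rw [← HomologicalComplex.exactAt_iff_isZero_homology,
    HomologicalComplex.exactAt_iff' _ (-1) 0 1 (by simp) (by simp)]
  refine (ShortComplex.exact_iff_epi _ ?_).2 this
  refine (cancel_epi (F.map (K.d (-1) 0))).1 ?_
  exact (ShortComplex.zero (((F.mapHomologicalComplex (.up ℤ)).obj K).sc' (-1) 0 1)).trans
    comp_zero.symm

variable [EnoughProjectives A]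

/-- The sum of lifts of `f` and `g` to resolutions lifts `f + g`. -/
instance CategoryTheory.Functor.leftDerived_additive (j : ℕ) : (F.leftDerived j).Additive where
  map_add {X Y f g} := by
    let R := projectiveResolution X
    let S := projectiveResolution Y
    rw [F.leftDerived_map_eq j f _ (ProjectiveResolution.lift_commutes f R S),
      F.leftDerived_map_eq j g _ (ProjectiveResolution.lift_commutes g R S),
      F.leftDerived_map_eq j (f + g) (P := R) (Q := S)
        (ProjectiveResolution.lift f R S + ProjectiveResolution.lift g R S) (by
          rw [Preadditive.add_comp, ProjectiveResolution.lift_commutes,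
            ProjectiveResolution.lift_commutes, Functor.map_add, Preadditive.comp_add]),
      Functor.map_add, Preadditive.add_comp, Preadditive.comp_add]

lemma CategoryTheory.Functor.isZero_obj_biproduct_iff {C : Type u} [Category.{v} C] [Preadditive C]
    [HasFiniteBiproducts C] (G : C ⥤ B) [G.Additive] (M : C) (n : ℕ) (hn : n ≠ 0) :
    IsZero (G.obj (⨁ fun _ : Fin n => M)) ↔ IsZero (G.obj M) := by
  constructor
  · intro h
    have : NeZero n := ⟨hn⟩
    have : Mono (G.map (biproduct.ι (fun _ : Fin n => M) 0)) := inferInstance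
    exact h.of_mono (G.map (biproduct.ι (fun _ : Fin n => M) 0))
  · intro h
    rw [IsZero.iff_id_eq_zero, ← G.map_id, ← biproduct.total, G.map_sum]
    refine Finset.sum_eq_zero fun i _ => ?_
    rw [G.map_comp, h.eq_of_tgt (G.map (biproduct.π (fun _ : Fin n => M) i)) 0, zero_comp]

namespace QuasiProj.IsNormalizedResolution

open HomotopyCategory

variable {K : CochainComplex A ℤ} {M : A}

lemma isZero_leftDerived_homology_zero_iff (hK : IsNormalizedResolution K M) (j : ℕ) :
    IsZero ((F.leftDerived j).obj (K.homology 0)) ↔ IsZero ((F.leftDerived j).obj M) := by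
  obtain ⟨n, e, h0⟩ := hK.homology
  rw [((F.leftDerived j).mapIso (e 0).some).isZero_iff]
  exact (F.leftDerived j).isZero_obj_biproduct_iff M _ h0

/-- Above the top degree `d` where the left derived functors of `F` do not vanish on `M`, the
left derived functors of `F` at the lowest homology object of a normalized resolution of `M`
are computed by applying `F` to the resolution. -/
lemma nonempty_leftDerived_homology_zero_iso (hK : IsNormalizedResolution K M) (d : ℕ)
    (hd : ∀ j : ℕ, d < j → IsZero ((F.leftDerived j).obj M)) (j : ℕ) (hj : d ≤ j) :
    Nonempty ((F.leftDerived j).obj (K.homology 0) ≅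
      (mapHomology F (-j)).obj ((quotient _ _).obj K)) := by
  let _ := HasDerivedCategory.standard A
  have := hK.isGE
  obtain ⟨b, _⟩ := hK.boundedAbove
  let V : ObjectProperty (HomotopyCategory A (.up ℤ)) := fun X =>
    ∀ n ∈ Set.Iic (-(d : ℤ)), IsZero ((mapHomology F n).obj X)
  have : V.IsClosedUnderIsomorphisms := instIsClosedUnderIsomorphismsMapHomology F _
  have : V.IsTriangulatedClosed₂ := instIsTriangulatedClosed₂MapHomology F _
  -- Vanishing of hyperhomology is paired with K-projectivity so that triangles of the derived
  -- category can be lifted.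
  let T : ObjectProperty (HomotopyCategory A (.up ℤ)) := V ⊓ minusOf (isProjective A)
  have hT := minusOf_le_leftOrthogonal (isProjective A) (fun _ h => h)
  have eK (i : ℤ) : (DerivedCategory.homologyFunctor A i).obj (DerivedCategory.Q.obj K) ≅
      K.homology i := (DerivedCategory.homologyFunctorFactors A i).app K
  obtain ⟨S, hS, hS₂, h₁, h₃, e₁, e₃⟩ :=
    DerivedCategory.exists_truncation_triangle (DerivedCategory.Q.obj K) 0
  have h₁' : S.obj₁.IsGE 0 := by
    rw [DerivedCategory.isGE_iff]
    intro i hi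
    exact ((K.isZero_of_isGE 0 i hi).of_iso (eK i)).of_iso (e₁ i hi.le).some
  -- `e₃` describes only positive degrees, hence the `max`.
  have h₃' : S.obj₃.IsLE (max b 0) := by
    rw [DerivedCategory.isLE_iff]
    intro i hi
    exact ((K.isZero_of_isLE b i (by lia)).of_iso (eK i)).of_iso (e₃ i (by lia)).some
  obtain ⟨X₃, hX₃, ⟨f₃⟩⟩ := (ObjectProperty.prop_map_iff _ _ _).1
    (DerivedCategory.map_Qh_of_homology T (fun X hX => hT X hX.2) S.obj₃ (0 + 1) (max b 0) M
      fun i => by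
        by_cases hi : 0 < i
        · obtain ⟨n, e, -⟩ := hK.homology
          refine Or.inr ⟨⟨n i, ⟨(e₃ i hi).some ≪≫ eK i ≪≫ (e i).some⟩⟩,
            map_Qh_single _ (projectiveResolution M) i ⟨fun n hn => ?_, ?_⟩⟩
          -- The relevant derived functor has index `k = i - n`, and `i > 0`, `n ≤ -d` give `k > d`.
          · obtain ⟨k, hk⟩ : ∃ k : ℕ, -(k : ℤ) = -i + n :=
              ⟨(i - n).toNat, by simp only [Set.mem_Iic] at hn; lia⟩
            exact ((hd k (by simp only [Set.mem_Iic] at hn; lia)).of_iso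
              ((projectiveResolution M).nonempty_leftDerived_iso_mapHomology F k _ hk).some.symm).of_iso
                (mapHomologyShiftIso F _ (-i) n (-i + n) rfl)
          · exact ObjectProperty.le_shift (minusOf (isProjective A)) (-i) _
              ((minusOf_quotient_obj_iff _).2 (CochainComplex.minusOf_cochainComplex
                (projectiveResolution M) fun i => (projectiveResolution M).projective i))
        · exact Or.inl (S.obj₃.isZero_of_isGE (0 + 1) i (by lia)))
  let R := projectiveResolution (K.homology 0)
  let X₁ : HomotopyCategory A (.up ℤ) := ((quotient _ _).obj R.cochainComplex)⟦(-0 : ℤ)⟧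
  have hX₁ : minusOf (isProjective A) X₁ :=
    ObjectProperty.le_shift (minusOf (isProjective A)) (-0) _
      ((minusOf_quotient_obj_iff _).2 (CochainComplex.minusOf_cochainComplex R R.projective))
  obtain ⟨X₂, f, g, h, hD, ⟨f₂⟩⟩ := DerivedCategory.exists_lift_triangle hS (hT _ hX₃.2)
    ((DerivedCategory.nonempty_Qh_resolution_shift_iso R 0).some ≪≫
      ((S.obj₁.nonempty_iso_single_homology 0).some ≪≫
        (DerivedCategory.singleFunctor A 0).mapIso ((e₁ 0 le_rfl).some ≪≫ eK 0)).symm) f₃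
  have hX₂ := ObjectProperty.ext_of_isTriangulatedClosed₂ _ _ hD (hT _ hX₁) (hT _ hX₃.2)
  obtain ⟨e'⟩ := DerivedCategory.nonempty_iso_of_Qh_iso hX₂
    (hT _ ((minusOf_quotient_obj_iff K).2 hK.minusOf_isProjective))
    (f₂ ≪≫ eqToIso hS₂ ≪≫ ((DerivedCategory.quotientCompQhIso A).app K).symm)
  -- The third vertex must vanish in degrees `-j` and `-j - 1`, both at most `-d`; this is why `j =
  -- d` is allowed.
  have : IsIso ((mapHomology F (-j)).map f) :=
    isIso_mapHomology_mor₁ F hD (-j) (hX₃.1 _ (by simp only [Set.mem_Iic]; lia))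
    (hX₃.1 _ (by simp only [Set.mem_Iic]; lia))
  exact ⟨(R.nonempty_leftDerived_iso_mapHomology F j _ rfl).some ≪≫
    (mapHomologyShiftIso F _ (-0) (-j) (-j) (by simp)).symm ≪≫
    asIso ((mapHomology F (-j)).map f) ≪≫ (mapHomology F (-j)).mapIso e'⟩

/-- In positive degrees, the left derived functors at the cokernel in degree `0` are computed by
the resolution. -/
lemma nonempty_leftDerived_opcycles_iso (hK : IsNormalizedResolution K M) (j : ℕ) (hj : 0 < j) :
    Nonempty ((F.leftDerived j).obj (K.opcycles 0) ≅
      (mapHomology F (-j)).obj ((quotient _ _).obj K)) := by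
  have := hK.projective
  have := hK.isGE
  let R := CochainComplex.resolutionOfIsGE (K := K) (K.pOpcycles 0) (by simp)
    (ShortComplex.exact_of_g_is_cokernel _ (K.opcyclesIsCokernel (-1) 0 (by simp)))
  -- Restriction to degrees `≤ 0` loses the differential out of degree `0`, so the homologies are
  -- compared only for positive `j`.
  obtain _ | j := j
  · lia
  exact ⟨R.isoLeftDerivedObj F (j + 1) ≪≫
    ((F.mapHomologicalComplex (.up ℤ)).obj K).restrictionHomologyIso
      ComplexShape.embeddingDownNat (j + 2) (j + 1) j (by simp)
      (by simp) (i' := -(j + 2 : ℕ)) (j' := -(j + 1 : ℕ)) (k' := -(j : ℕ)) (by simp)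
      (by simp) (by simp) (by simp; ring) (by simp) ≪≫
    (mapHomologyQuotientObjIso F _ K).symm⟩

end QuasiProj.IsNormalizedResolution

end

/-! ### Suprema in `EReal`, and passage between chain complexes and normalized resolutions -/

namespace QuasiProj

/-- Integers are discrete: if `a` were not attained, `a - 1` would already be an upper bound. -/
lemma iSup_intCast_eq_iff (p : ℤ → Prop) (a : ℤ) :
    (⨆ (i : ℤ) (_ : p i), ((i : ℝ) : EReal)) = ((a : ℝ) : EReal) ↔ p a ∧ ∀ i, p i → i ≤ a := by
  constructor
  · intro h
    have h₁ (i : ℤ) (hi : p i) : i ≤ a := by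
      have := le_iSup₂ (f := fun (i : ℤ) (_ : p i) => ((i : ℝ) : EReal)) i hi
      rw [h] at this
      exact_mod_cast this
    refine ⟨?_, h₁⟩
    by_contra ha
    have h₂ : (⨆ (i : ℤ) (_ : p i), ((i : ℝ) : EReal)) ≤ (((a - 1 : ℤ) : ℝ) : EReal) := by
      refine iSup₂_le fun i hi => ?_
      have : i ≤ a - 1 := by
        have := h₁ i hi
        have : i ≠ a := by rintro rfl; exact ha hi
        lia
      exact_mod_cast this
    rw [h] at h₂
    have : a ≤ a - 1 := by exact_mod_cast h₂
    lia
  · rintro ⟨ha, h⟩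
    refine le_antisymm (iSup₂_le fun i hi => ?_) ?_
    · exact_mod_cast h i hi
    · exact le_iSup₂ (f := fun (i : ℤ) (_ : p i) => ((i : ℝ) : EReal)) a ha

variable {A : Type u} [Category.{v} A] [Abelian A]

lemma sup_eq_iff (X : ChainComplex A ℤ) (a : ℤ) :
    sup X = ((a : ℝ) : EReal) ↔ ¬ IsZero (X.X a) ∧ ∀ i, ¬ IsZero (X.X i) → i ≤ a :=
  iSup_intCast_eq_iff _ a

lemma hsup_eq_iff (X : ChainComplex A ℤ) (a : ℤ) :
    hsup X = ((a : ℝ) : EReal) ↔ ¬ IsZero (X.homology a) ∧ ∀ i, ¬ IsZero (X.homology i) → i ≤ a :=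
  iSup_intCast_eq_iff _ a

section

variable {B : Type u'} [Category.{v'} B] [Abelian B] [EnoughProjectives A]
  (F : A ⥤ B) [F.Additive]

lemma leftDerivedSup_eq_iff (X : A) (d : ℕ) :
    leftDerivedSup F X = ((d : ℝ) : EReal) ↔ ¬ IsZero ((F.leftDerived d).obj X) ∧
      ∀ i, ¬ IsZero ((F.leftDerived i).obj X) → i ≤ d := by
  have h := iSup_intCast_eq_iff
    (· ∈ Nat.cast '' {i : ℕ | ¬ IsZero ((F.leftDerived i).obj X)}) d
  rw [iSup_image] at h
  simpa [leftDerivedSup] using h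

lemma leftDerivedSup_congr {X Y : A} (e : X ≅ Y) : leftDerivedSup F X = leftDerivedSup F Y := by
  simp only [leftDerivedSup, ((F.leftDerived _).mapIso e).isZero_iff]

/-- The left derived functors of a right exact functor at the cokernel in degree `0` of a
normalized resolution of `M` vanish above the same degree as those at `M`. -/
lemma IsNormalizedResolution.leftDerivedSup_opcycles {K : CochainComplex A ℤ} {M : A}
    (hK : IsNormalizedResolution K M) [PreservesFiniteColimits F] (d : ℕ)
    (hd : leftDerivedSup F M = ((d : ℝ) : EReal)) :
    leftDerivedSup F (K.opcycles 0) = ((d : ℝ) : EReal) ∧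
      (0 < d → Nonempty ((F.leftDerived d).obj (K.homology 0) ≅
        (F.leftDerived d).obj (K.opcycles 0))) := by
  rw [leftDerivedSup_eq_iff] at hd ⊢
  obtain ⟨h₁, h₂⟩ := hd
  have h₃ := hK.nonempty_leftDerived_homology_zero_iso F d fun j hj => by
    by_contra h
    have := h₂ j h
    lia
  have h₄ (j : ℕ) (hj : 0 < j) (hj' : d ≤ j) :
      Nonempty ((F.leftDerived j).obj (K.homology 0) ≅ (F.leftDerived j).obj (K.opcycles 0)) :=
    ⟨(h₃ j hj').some ≪≫ (hK.nonempty_leftDerived_opcycles_iso F j hj).some.symm⟩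
  refine ⟨⟨fun h => h₁ ?_, fun j h => ?_⟩, fun hd => h₄ d hd le_rfl⟩
  · rw [← hK.isZero_leftDerived_homology_zero_iff F]
    -- For `d = 0`, `h₄` is unavailable in degree `0`, and right exactness takes its place.
    obtain rfl | hd := Nat.eq_zero_or_pos d
    · exact (isZero_mapHomology_zero F K (h.of_iso (F.leftDerivedZeroIsoSelf.app _).symm)).of_iso
        (h₃ 0 le_rfl).some
    · exact h.of_iso (h₄ d hd le_rfl).some
  · by_contra hj
    refine h₁.elim (by_contra fun _ => hj (h₂ j fun h' => h ?_))
    rw [← hK.isZero_leftDerived_homology_zero_iff F] at h'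
    exact h'.of_iso (h₄ j (by lia) (by lia)).some.symm

end

/-- The embedding `n ↦ h - n` of cohomological into homological indexing. -/
@[simps]
def embeddingUpIntDownIntSub (h : ℤ) :
    (ComplexShape.up ℤ).Embedding (ComplexShape.down ℤ) where
  f n := h - n
  injective_f _ _ := by simp
  rel := by simp; lia

instance (h : ℤ) : (embeddingUpIntDownIntSub h).IsRelIff where
  rel' i j hij := by
    change (h - j) + 1 = h - i at hij
    change i + 1 = j
    lia

lemma not_isZero_iff_of_iso_biproduct {M : A} (hM : ¬ IsZero M) {n : ℕ} {X : A}
    (e : X ≅ ⨁ fun _ : Fin n => M) :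
    ¬ IsZero X ↔ n ≠ 0 := by
  rw [e.isZero_iff]
  constructor
  · rintro h rfl
    exact h ((IsZero.iff_id_eq_zero _).2 (biproduct.hom_ext _ _ fun i => i.elim0))
  · intro hn h
    exact hM ((Functor.isZero_obj_biproduct_iff (𝟭 A) M n hn).1 h)

lemma IsFiniteQuasiProjectiveResolution.exists_isNormalizedResolution {P : ChainComplex A ℤ}
    {M : A} (hP : IsFiniteQuasiProjectiveResolution P M) (hM : ¬ IsZero M) :
    ∃ (p : ℕ) (K : CochainComplex A ℤ), IsNormalizedResolution K M ∧ K.IsStrictlyGE (-p) ∧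
      sup P - hsup P = ((p : ℝ) : EReal) := by
  obtain ⟨b, hb⟩ := hP.boundedAbove
  obtain ⟨a, ha⟩ := hP.boundedBelow
  obtain ⟨n, e, j, hj⟩ := hP.homology
  have hn (i : ℤ) : ¬ IsZero (P.homology i) ↔ n i ≠ 0 :=
    not_isZero_iff_of_iso_biproduct hM (e i).some
  have hX (i : ℤ) (hi : ¬ IsZero (P.homology i)) : ¬ IsZero (P.X i) := fun h =>
    hi (ShortComplex.isZero_homology_of_isZero_X₂ _ h)
  have hb' (i : ℤ) (hi : ¬ IsZero (P.X i)) : i ≤ b := by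
    by_contra! h
    exact hi (hb i h)
  obtain ⟨h, h₁, h₂⟩ := Int.exists_greatest_of_bdd (P := fun i => ¬ IsZero (P.homology i))
    ⟨b, fun i hi => hb' i (hX i hi)⟩ ⟨j, (hn j).2 hj⟩
  obtain ⟨q, h₃, h₄⟩ := Int.exists_greatest_of_bdd (P := fun i => ¬ IsZero (P.X i))
    ⟨b, hb'⟩ ⟨h, hX h h₁⟩
  have hhq := h₄ h (hX h h₁)
  -- Here `h` is `hsup P` and `q` is `sup P`; the reindexing moves degree `h` to `0` and degree `q`
  -- to `-(q - h)`.
  let K : CochainComplex A ℤ := P.restriction (embeddingUpIntDownIntSub h)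
  have eK (i : ℤ) : K.homology i ≅ P.homology (h - i) :=
    P.restrictionHomologyIso (embeddingUpIntDownIntSub h) (i - 1) i (i + 1) (by simp) (by simp)
      (i' := h - i + 1) (j' := h - i) (k' := h - i - 1) (by simp; ring) (by simp)
      (by simp; ring) (by simp) (by simp)
  refine ⟨(q - h).toNat, K, ⟨⟨h - a, ?_⟩, fun i => hP.projective _, ?_, fun i => n (h - i),
    fun i => ⟨eK i ≪≫ (e _).some⟩, ?_⟩, ?_, ?_⟩
  · rw [CochainComplex.isStrictlyLE_iff]
    exact fun i hi => ha (h - i) (by lia)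
  · rw [CochainComplex.isGE_iff]
    intro i hi
    rw [HomologicalComplex.exactAt_iff_isZero_homology]
    refine IsZero.of_iso ?_ (eK i)
    by_contra hi'
    have := h₂ _ hi'
    lia
  · simpa using (hn h).1 h₁
  · rw [CochainComplex.isStrictlyGE_iff]
    intro i hi
    change IsZero (P.X (h - i))
    by_contra hi'
    have := h₄ _ hi'
    lia
  · rw [(sup_eq_iff P q).2 ⟨h₃, h₄⟩, (hsup_eq_iff P h).2 ⟨h₁, h₂⟩, ← EReal.coe_sub,
      ← Int.cast_sub, ← Int.cast_natCast (R := ℝ) (q - h).toNat,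
      Int.toNat_of_nonneg (sub_nonneg.2 hhq)]

namespace IsNormalizedResolution

variable {K : CochainComplex A ℤ} {M : A}

/-- The homology of a cochain complex, viewed as a chain complex. -/
noncomputable def restrictionHomologyIso (K : CochainComplex A ℤ) (i : ℤ) :
    (K.restriction ComplexShape.embeddingDownIntUpInt).homology i ≅ K.homology (-i) :=
  K.restrictionHomologyIso ComplexShape.embeddingDownIntUpInt (i + 1) i (i - 1) (by simp) (by simp)
    (i' := -i - 1) (j' := -i) (k' := -i + 1) (by simp; ring) (by simp)
    (by simp; ring) (by simp) (by simp)

lemma hsup_restriction (hK : IsNormalizedResolution K M) (hM : ¬ IsZero M) :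
    hsup (K.restriction ComplexShape.embeddingDownIntUpInt) = 0 := by
  have := (hsup_eq_iff (K.restriction ComplexShape.embeddingDownIntUpInt) 0).2
    ⟨fun h => hK.not_isZero_homology_zero hM (h.of_iso (restrictionHomologyIso K 0).symm),
      fun i hi => by
        by_contra! h
        have := hK.isGE
        exact hi ((K.isZero_of_isGE 0 (-i) (by lia)).of_iso (restrictionHomologyIso K i))⟩
  simpa using this

lemma restriction (hK : IsNormalizedResolution K M) (r : ℕ) [K.IsStrictlyGE (-r)] :
    IsFiniteQuasiProjectiveResolution (K.restriction ComplexShape.embeddingDownIntUpInt) M where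
  boundedBelow := by
    obtain ⟨b, _⟩ := hK.boundedAbove
    exact ⟨-b, fun i hi => K.isZero_of_isStrictlyLE b (-i) (by lia)⟩
  projective i := hK.projective (-i)
  homology := by
    obtain ⟨n, e, h0⟩ := hK.homology
    exact ⟨fun i => n (-i), fun i => ⟨restrictionHomologyIso K i ≪≫ (e _).some⟩, 0, by simpa⟩
  boundedAbove := ⟨r, fun i hi => K.isZero_of_isStrictlyGE (-r) (-i) (by lia)⟩

lemma qpd_le (hK : IsNormalizedResolution K M) (hM : ¬ IsZero M) (r : ℕ)
    [K.IsStrictlyGE (-r)] : qpd M ≤ ((r : ℝ) : EReal) := by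
  rw [qpd, if_neg hM]
  refine (iInf₂_le (κ := fun P => IsFiniteQuasiProjectiveResolution P M)
    (f := fun P _ => sup P - hsup P) _ (hK.restriction r)).trans ?_
  rw [hK.hsup_restriction hM, sub_zero]
  refine iSup₂_le fun i hi => ?_
  have : i ≤ (r : ℤ) := by
    by_contra! h
    exact hi (K.isZero_of_isStrictlyGE (-r) (-i) (by lia))
  exact_mod_cast this

end IsNormalizedResolution

/-- The quasi-projective dimension is attained by a normalized resolution. -/
lemma exists_isNormalizedResolution_qpd {M : A} (hM : ¬ IsZero M) (h : qpd M < ⊤) :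
    ∃ (r : ℕ) (K : CochainComplex A ℤ), IsNormalizedResolution K M ∧ K.IsStrictlyGE (-r) ∧
      qpd M = ((r : ℝ) : EReal) ∧ ∀ (p : ℕ) (L : CochainComplex A ℤ),
        IsNormalizedResolution L M → L.IsStrictlyGE (-p) → r ≤ p := by
  classical
  have h' : ∃ (r : ℕ) (K : CochainComplex A ℤ), IsNormalizedResolution K M ∧
      K.IsStrictlyGE (-r) := by
    rw [qpd, if_neg hM, iInf_lt_iff] at h
    obtain ⟨P, h⟩ := h
    obtain ⟨hP, -⟩ := iInf_lt_iff.1 h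
    obtain ⟨p, K, hK, hp, -⟩ := hP.exists_isNormalizedResolution hM
    exact ⟨p, K, hK, hp⟩
  -- The infimum is attained because each `sup P - hsup P` is a natural number bounding the length
  -- of a normalized resolution.
  obtain ⟨K, hK, hr⟩ := Nat.find_spec h'
  refine ⟨Nat.find h', K, hK, hr, le_antisymm (hK.qpd_le hM _) ?_,
    fun p L hL hp => Nat.find_min' h' ⟨L, hL, hp⟩⟩
  rw [qpd, if_neg hM]
  refine le_iInf₂ fun P hP => ?_
  obtain ⟨p, L, hL, hp, e⟩ := hP.exists_isNormalizedResolution hM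
  rw [e]
  exact_mod_cast Nat.find_min' h' ⟨L, hL, hp⟩

/-- The cokernel of `P.d 1 0` for the chain complex `P` corresponding to a cochain complex. -/
lemma nonempty_cokernel_restriction_iso (K : CochainComplex A ℤ) :
    Nonempty (cokernel ((K.restriction ComplexShape.embeddingDownIntUpInt).d 1 0) ≅
      K.opcycles 0) :=
  ⟨(cokernelIsCokernel _).coconePointUniqueUpToIso
    (K.opcyclesIsCokernel (-1) 0 (by simp))⟩

end QuasiProj

theorem proposition2p2 {A : Type u} [Category.{v} A] [Abelian A]
    [EnoughProjectives A]
    (PP : ObjectProperty A) (hPP : ∀ X : A, PP X → Projective X)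
    [PP.IsStableUnderRetracts] [PP.IsClosedUnderFiniteCoproducts]
    (M : A) (hM : ¬ IsZero M) (hqpd : QuasiProj.qpd M < ⊤)
    (Q : ProjectiveResolution M) (hQ : ∀ i : ℕ, PP (Q.complex.X i)) :
    ∃ (r s : ℕ) (P : ChainComplex A ℤ),
      (∀ i : ℤ, PP (P.X i)) ∧
      (∀ i : ℤ, (r : ℤ) < i → IsZero (P.X i)) ∧
      (∀ i : ℤ, i < -(s : ℤ) → IsZero (P.X i)) ∧
      QuasiProj.hsup P = 0 ∧
      QuasiProj.IsQuasiProjectiveResolution P M ∧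
      QuasiProj.qpd M = ((r : ℝ) : EReal) ∧
      projectiveDimension (cokernel (P.d 1 0)) = (r : WithBot ℕ∞) ∧
      ∀ {B : Type u'} [Category.{v'} B] [Abelian B] (F : A ⥤ B) [F.Additive]
        [PreservesFiniteColimits F] (d : ℕ),
        QuasiProj.leftDerivedSup F M = ((d : ℝ) : EReal) →
          QuasiProj.leftDerivedSup F (cokernel (P.d 1 0)) = ((d : ℝ) : EReal) ∧
          (0 < d → Nonempty ((F.leftDerived d).obj (P.homology 0) ≅
            (F.leftDerived d).obj (cokernel (P.d 1 0)))) := by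
  obtain ⟨r, K₀, hK₀, _, hr, hmin⟩ := QuasiProj.exists_isNormalizedResolution_qpd hM hqpd
  -- The replacement still vanishes below `-r`, and `hmin` ranges over all normalized resolutions,
  -- so minimality carries over to `K`.
  obtain ⟨K, ⟨⟨b, _⟩, hKP⟩, hK, _⟩ := hK₀.exists_minusOf hPP Q hQ r
  obtain ⟨e⟩ := QuasiProj.nonempty_cokernel_restriction_iso K
  have e₀ : (K.restriction ComplexShape.embeddingDownIntUpInt).homology 0 ≅ K.homology 0 :=
    QuasiProj.IsNormalizedResolution.restrictionHomologyIso K 0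
  refine ⟨r, b.toNat, K.restriction ComplexShape.embeddingDownIntUpInt, fun i => hKP (-i),
    fun i hi => K.isZero_of_isStrictlyGE (-r) (-i) (by lia),
    fun i hi => K.isZero_of_isStrictlyLE b (-i) (by lia), hK.hsup_restriction hM,
    (hK.restriction r).toIsQuasiProjectiveResolution, hr, ?_, fun F _ _ d hd => ?_⟩
  · rw [projectiveDimension_eq_of_iso e]
    exact hK.projectiveDimension_opcycles hM r inferInstance hmin
  · obtain ⟨h₁, h₂⟩ := hK.leftDerivedSup_opcycles F d hd
    refine ⟨(QuasiProj.leftDerivedSup_congr F e).trans h₁, fun h => ?_⟩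
    exact ⟨(F.leftDerived d).mapIso e₀ ≪≫ (h₂ h).some ≪≫ (F.leftDerived d).mapIso e.symm⟩
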